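/- Let $\mathcal E$ be a finite set of links, $\|\cdot\|$ the $\ell_1$-norm on $\mathbb R^{\mathcal E}$, and $R\in\mathbb R_+^{\mathcal E\times\mathcal E}$ a routing matrix, i.e. $\sum_j R_{ij}\le 1$ for all $i$, that is outflow-connected: from every $i\in\mathcal E$ there is a path (possibly of length $0$) along positive entries of $R$ to some $j$ with $\sum_k R_{jk}<1$. Let $f=(f_i)_{i\in\mathcal E}:\mathbb R_+^{\mathcal E}\to\mathbb R_+^{\mathcal E}$ be locally Lipschitz with $f_i(x)=0$ if and only if $x_i=0$. Consider the flow network $$\dot x=\lambda-(I-R^T)f(x),\qquad x(t)\in\mathbb R_+^{\mathcal E},\ t\ge 0,$$ with inflows $\lambda:[0,\infty)\to\mathbb R_+^{\mathcal E}$ measurable and locally essentially bounded, and (Carathéodory) solutions on $[0,\infty)$. Write $a(t)=(I-R^T)^{-1}\lambda(t)$, $z(t)=(I-R^T)^{-1}x(t)$, and $L=\liminf_{\|x\|\to\infty,\,x\ge 0}\sum_i f_i(x)\in[0,\infty]$. Comparison functions of class $\mathcal K_\infty$ and $\mathcal{KL}$ are continuous; $\mu\in\mathcal K_\infty$ is strictly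 increasing on $[0,\infty)$ with $\mu(0)=0$ and $\mu(s)\to\infty$; $\beta\in\mathcal{KL}$ has $\beta(0,t)=0$, is strictly increasing in its first argument, and nonincreasing with limit $0$ in its second. Then $I-R^T$ is invertible, and the following hold. 1. (iISS) There are $\beta\in\mathcal{KL}$ and $\mu_1,\mu_2\in\mathcal K_\infty$ such that for every inflow, every solution and all $t\ge0$, $$\|z(t)\|\le\beta(\|z(0)\|,t)+\mu_1\Big(\int_0^t\mu_2(\|a(s)\|)\,ds\Big).$$ 2. (ISS) If $\operatorname{ess\,sup}_{t\ge0}\sum_i a_i(t)<L$, then there are $\beta\in\mathcal{KL}$ and $\mu\in\mathcal K_\infty$ such that for every solution and all $t\ge0$, $$\|z(t)\|\le\beta(\|z(0)\|,t)+\mu\big(\operatorname{ess\,sup}_{s\ge0}\|a(s)\|\big).$$ Here, for each $U<L$, the same $\beta,\mu$ can be used for all inflows with $\operatorname{ess\,sup}_{t\ge 0}\sum_i a_i(t)\le U$; and if $L=\infty$, the same $\beta,\mu$ can be used for all essentially bounded inflows. 3. (Strong iISS) If $L>0$ (i.e. if some inflow satisfies the condition in 2), the network is Strong iISS, both in the coordinates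 $x$ with input $\lambda$ and in the coordinates $z$ with input $a$. For state $\xi$ and input $u$ this means: there are $\beta\in\mathcal{KL}$, $\mu_1,\mu_2,\mu\in\mathcal K_\infty$ and $U>0$ such that, for all trajectories and all $t\ge0$, $\|\xi(t)\|\le\beta(\|\xi(0)\|,t)+\mu_1\big(\int_0^t\mu_2(\|u(s)\|)\,ds\big)$, and $\|\xi(t)\|\le\beta(\|\xi(0)\|,t)+\mu\big(\operatorname{ess\,sup}_{s\ge0}\|u(s)\|\big)$ whenever $\operatorname{ess\,sup}_{s\ge0}\|u(s)\|<U$. -/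

import Mathlib

open Filter Topology MeasureTheory
open scoped ENNReal

noncomputable section

/-- A comparison function of class `K_∞` on `[0, ∞)`; only the values at nonnegative reals matter. -/
structure IsClassKInf (μ : ℝ → ℝ) : Prop where
  continuousOn : ContinuousOn μ (Set.Ici 0)
  strictMonoOn : StrictMonoOn μ (Set.Ici 0)
  map_zero : μ 0 = 0
  tendsto_atTop : Tendsto μ atTop atTop

/-- A comparison function of class `KL` on `[0, ∞) × [0, ∞)`: continuous, zero at zero and strictly
increasing in the first variable, nonincreasing with limit `0` in the second one. -/
structure IsClassKL (β : ℝ → ℝ → ℝ) : Prop where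
  continuousOn : ContinuousOn (Function.uncurry β) (Set.Ici 0 ×ˢ Set.Ici 0)
  map_zero : ∀ t, 0 ≤ t → β 0 t = 0
  strictMonoOn : ∀ t, 0 ≤ t → StrictMonoOn (fun s => β s t) (Set.Ici 0)
  antitoneOn : ∀ s, 0 ≤ s → AntitoneOn (β s) (Set.Ici 0)
  tendsto_zero : ∀ s, 0 ≤ s → Tendsto (β s) atTop (𝓝 0)

variable {E : Type*} [Fintype E]

/-- The `ℓ₁` norm of a vector. -/
def l1Norm (x : E → ℝ) : ℝ := ∑ i, |x i|

/-- `ess sup_{t ≥ 0} ‖u(t)‖₁`, as an extended nonnegative real. -/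
def essSupNorm (u : ℝ → E → ℝ) : ℝ≥0∞ :=
  essSup (fun t => ENNReal.ofReal (l1Norm (u t))) (volume.restrict (Set.Ici 0))

/-! ### Stability notions

A system with inputs is represented by the relation `Traj u x`: the state trajectory `x` on
`[0, ∞)` is a trajectory of the system for the input `u`. -/

/-- Integral input-to-state stability. -/
def IsIISS (Traj : (ℝ → E → ℝ) → (ℝ → E → ℝ) → Prop) : Prop :=
  ∃ (β : ℝ → ℝ → ℝ) (μ₁ μ₂ : ℝ → ℝ), IsClassKL β ∧ IsClassKInf μ₁ ∧ IsClassKInf μ₂ ∧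
    ∀ u x, Traj u x → ∀ t, 0 ≤ t →
      l1Norm (x t) ≤ β (l1Norm (x 0)) t + μ₁ (∫ s in (0 : ℝ)..t, μ₂ (l1Norm (u s)))

/-- Input-to-state stability (the bound is for essentially bounded inputs). -/
def IsISS (Traj : (ℝ → E → ℝ) → (ℝ → E → ℝ) → Prop) : Prop :=
  ∃ (β : ℝ → ℝ → ℝ) (μ : ℝ → ℝ), IsClassKL β ∧ IsClassKInf μ ∧
    ∀ u x, Traj u x → essSupNorm u < ⊤ → ∀ t, 0 ≤ t →
      l1Norm (x t) ≤ β (l1Norm (x 0)) t + μ (essSupNorm u).toReal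

/-- Strong integral input-to-state stability: with the same `β`, the system is integral
input-to-state stable, and input-to-state stable with respect to inputs that are smaller than
some threshold `U > 0`. -/
def IsStrongIISS (Traj : (ℝ → E → ℝ) → (ℝ → E → ℝ) → Prop) : Prop :=
  ∃ (β : ℝ → ℝ → ℝ) (μ₁ μ₂ μ : ℝ → ℝ),
    IsClassKL β ∧ IsClassKInf μ₁ ∧ IsClassKInf μ₂ ∧ IsClassKInf μ ∧
    (∀ u x, Traj u x → ∀ t, 0 ≤ t →
      l1Norm (x t) ≤ β (l1Norm (x 0)) t + μ₁ (∫ s in (0 : ℝ)..t, μ₂ (l1Norm (u s)))) ∧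
    ∃ U : ℝ, 0 < U ∧ ∀ u x, Traj u x → essSupNorm u < ENNReal.ofReal U → ∀ t, 0 ≤ t →
      l1Norm (x t) ≤ β (l1Norm (x 0)) t + μ (essSupNorm u).toReal

/-! ### Dynamical flow networks -/

/-- `R i j` is the fraction of the outflow from link `i` that proceeds to link `j`. -/
structure IsRoutingMatrix (R : Matrix E E ℝ) : Prop where
  nonneg : ∀ i j, 0 ≤ R i j
  row_sum_le_one : ∀ i, ∑ j, R i j ≤ 1

/-- From every link there is a (possibly trivial) path to a link where some mass leaves. -/
def OutflowConnected (R : Matrix E E ℝ) : Prop :=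
  ∀ i, ∃ j, Relation.ReflTransGen (fun k l => 0 < R k l) i j ∧ ∑ k, R j k < 1

/-- The flow functions `f = (f_i)` on the nonnegative orthant: locally Lipschitz, nonnegative, and
`f_i x = 0` if and only if `x_i = 0`. -/
structure IsFlowFunction (f : (E → ℝ) → E → ℝ) : Prop where
  locallyLipschitzOn : LocallyLipschitzOn {x | 0 ≤ x} f
  nonneg : ∀ x, 0 ≤ x → 0 ≤ f x
  eq_zero_iff : ∀ x, 0 ≤ x → ∀ i, f x i = 0 ↔ x i = 0

/-- An exogenous inflow on `[0, ∞)`: nonnegative, measurable, locally essentially bounded. -/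
structure IsInflow (lam : ℝ → E → ℝ) : Prop where
  nonneg : ∀ t, 0 ≤ t → 0 ≤ lam t
  aestronglyMeasurable : AEStronglyMeasurable lam (volume.restrict (Set.Ici 0))
  locally_bounded : ∀ T : ℝ, ∃ C : ℝ, ∀ᵐ t ∂(volume.restrict (Set.Icc 0 T)), l1Norm (lam t) ≤ C

/-- `liminf` of the total outflow `∑ i, f_i x` as `‖x‖₁ → ∞` in the nonnegative orthant. -/
def liminfOutflow (f : (E → ℝ) → E → ℝ) : ℝ≥0∞ :=
  liminf (fun x => ENNReal.ofReal (∑ i, f x i)) (comap l1Norm atTop ⊓ 𝓟 {x : E → ℝ | 0 ≤ x})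

variable [DecidableEq E]

/-- `x` is a (Carathéodory) solution on `[0, ∞)`, with values in the nonnegative orthant, of the
network dynamics `ẋ = λ - (I - Rᵀ) f(x)` with exogenous inflow `λ = lam`. -/
structure IsSolution (R : Matrix E E ℝ) (f : (E → ℝ) → E → ℝ) (lam x : ℝ → E → ℝ) : Prop where
  inflow : IsInflow lam
  nonneg : ∀ t, 0 ≤ t → 0 ≤ x t
  continuousOn : ContinuousOn x (Set.Ici 0)
  integral_eq : ∀ t, 0 ≤ t → ∀ i,
    x t i = x 0 i + ∫ s in (0 : ℝ)..t, (lam s i - (1 - R.transpose).mulVec (f (x s)) i)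

/-- The network in the coordinates `z = (I - Rᵀ)⁻¹ x`, with input `a = (I - Rᵀ)⁻¹ λ`. -/
def IsTransformedSolution (R : Matrix E E ℝ) (f : (E → ℝ) → E → ℝ) (a z : ℝ → E → ℝ) : Prop :=
  ∃ lam x : ℝ → E → ℝ, IsSolution R f lam x ∧
    a = (fun t => (1 - R.transpose)⁻¹.mulVec (lam t)) ∧
    z = (fun t => (1 - R.transpose)⁻¹.mulVec (x t))

end

noncomputable section

/-! ### Comparison functions -/

/-! The total mass `V(x) = ∑ z_i` is linear in `x`, and the routing cancels in it: `V' = ∑ a_i - ∑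
f_i(x)`. A minimum principle makes `(I - Rᵀ)⁻¹` nonnegative with diagonal at least `1`, so `V = ‖z‖`
and `V` is comparable to `‖x‖`. Everything reduces to scalar balances `v' = A - p` with `(v, p)` in
the relation `D` of attainable pairs (`IsSolution.isScalarBalance`); by compactness, `p` is bounded
away from zero on compact sets of positive levels.

For iISS, subtract the accumulated inflow from `v`: the rest `w` satisfies `w' = -p`, and while it
exceeds that inflow, `v` lies in `[w, 2w]`, so `w` decays at a rate depending on `w` alone. For ISS,
the gain `μ` is chosen so that `v ≥ μ c` forces `p - c ≥ p / (1 + v)`; this decay rate does not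
involve `c`, hence one `β` serves all inflows. Such a `μ` exists when the outflow at high levels
exceeds the inflow bound, which is where `liminf ∑ f_i` enters. -/

theorem isClassKInf_const_mul {c : ℝ} (hc : 0 < c) : IsClassKInf (fun s => c * s) where
  continuousOn := by fun_prop
  strictMonoOn := fun _ _ _ _ h => mul_lt_mul_of_pos_left h hc
  map_zero := mul_zero c
  tendsto_atTop := tendsto_id.const_mul_atTop hc

theorem isClassKInf_id : IsClassKInf (fun s => s) where
  continuousOn := continuousOn_id
  strictMonoOn := fun _ _ _ _ h => h
  map_zero := rfl
  tendsto_atTop := tendsto_id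

theorem IsClassKInf.comp_const_mul {μ : ℝ → ℝ} (hμ : IsClassKInf μ) {c : ℝ} (hc : 0 < c) :
    IsClassKInf (fun s => μ (c * s)) where
  continuousOn := hμ.continuousOn.comp (by fun_prop) fun _ hs => mul_nonneg hc.le hs
  strictMonoOn := fun _ ha _ hb h => hμ.strictMonoOn (mul_nonneg hc.le ha)
    (mul_nonneg hc.le hb) (mul_lt_mul_of_pos_left h hc)
  map_zero := by simp [hμ.map_zero]
  tendsto_atTop := hμ.tendsto_atTop.comp (tendsto_id.const_mul_atTop hc)

theorem IsClassKInf.nonneg {μ : ℝ → ℝ} (hμ : IsClassKInf μ) {s : ℝ} (hs : 0 ≤ s) : 0 ≤ μ s :=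
  hμ.map_zero ▸ hμ.strictMonoOn.monotoneOn Set.self_mem_Ici hs hs

theorem IsClassKL.nonneg {β : ℝ → ℝ → ℝ} (hβ : IsClassKL β) {s t : ℝ} (hs : 0 ≤ s) (ht : 0 ≤ t) :
    0 ≤ β s t :=
  hβ.map_zero t ht ▸ (hβ.strictMonoOn t ht).monotoneOn Set.self_mem_Ici hs hs

theorem IsClassKL.comp_const_mul {β : ℝ → ℝ → ℝ} (hβ : IsClassKL β) {c : ℝ} (hc : 0 < c) :
    IsClassKL (fun s t => β (c * s) t) where
  continuousOn := hβ.continuousOn.comp (f := fun p : ℝ × ℝ => (c * p.1, p.2)) (by fun_prop)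
    fun _ hp => ⟨mul_nonneg hc.le hp.1, hp.2⟩
  map_zero := fun t ht => by simp [hβ.map_zero t ht]
  strictMonoOn := fun t ht _ ha _ hb h => hβ.strictMonoOn t ht (mul_nonneg hc.le ha)
    (mul_nonneg hc.le hb) (mul_lt_mul_of_pos_left h hc)
  antitoneOn := fun s hs => hβ.antitoneOn _ (mul_nonneg hc.le hs)
  tendsto_zero := fun s hs => hβ.tendsto_zero _ (mul_nonneg hc.le hs)

theorem IsClassKL.add {β γ : ℝ → ℝ → ℝ} (hβ : IsClassKL β) (hγ : IsClassKL γ) :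
    IsClassKL (fun s t => β s t + γ s t) where
  continuousOn := hβ.continuousOn.add hγ.continuousOn
  map_zero := fun t ht => by simp [hβ.map_zero t ht, hγ.map_zero t ht]
  strictMonoOn := fun t ht => (hβ.strictMonoOn t ht).add (hγ.strictMonoOn t ht)
  antitoneOn := fun s hs => (hβ.antitoneOn s hs).add (hγ.antitoneOn s hs)
  tendsto_zero := fun s hs => by simpa using (hβ.tendsto_zero s hs).add (hγ.tendsto_zero s hs)

/-! ### Class `KL` bounds from decay rates -/

/-- A primitive of a continuous function that is bounded below by `1` is an order isomorphism of
the real line. -/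
theorem exists_orderIso_hasDerivAt {k : ℝ → ℝ} (hk : Continuous k) (hk1 : ∀ v, 1 ≤ k v) :
    ∃ H : ℝ ≃o ℝ, ∀ v, HasDerivAt H (k v) v := by
  set h : ℝ → ℝ := fun u => ∫ v in (0 : ℝ)..u, k v with hh
  have hd : ∀ v, HasDerivAt h (k v) v := fun v =>
    (Continuous.integral_hasStrictDerivAt hk 0 v).hasDerivAt
  have hmono : StrictMono h := strictMono_of_deriv_pos fun v => by
    rw [(hd v).deriv]; exact zero_lt_one.trans_le (hk1 v)
  have hcont : Continuous h := continuous_iff_continuousAt.2 fun v => (hd v).continuousAt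
  -- Since `k ≥ 1`, `h` grows at least as fast as the identity, so it is unbounded on both sides and
  -- hence surjective.
  have hmono' : Monotone (fun v => h v - v) := by
    refine monotone_of_deriv_nonneg (fun v => ((hd v).sub (hasDerivAt_id v)).differentiableAt)
      fun v => ?_
    have hd' : HasDerivAt (fun v => h v - v) (k v - 1) v := (hd v).sub (hasDerivAt_id' v)
    rw [hd'.deriv]
    linarith [hk1 v]
  have h0 : h 0 = 0 := by simp [hh]
  have htop : Tendsto h atTop atTop := by
    refine tendsto_atTop_mono' _ ?_ tendsto_id
    filter_upwards [eventually_ge_atTop 0] with v hv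
    have := hmono' hv
    simp only [h0, id] at this ⊢
    linarith
  have hbot : Tendsto h atBot atBot := by
    refine tendsto_atBot_mono' _ ?_ tendsto_id
    filter_upwards [eventually_le_atBot 0] with v hv
    have := hmono' hv
    simp only [h0, id] at this ⊢
    linarith
  exact ⟨hmono.orderIsoOfSurjective h (hcont.surjective htop hbot), hd⟩

/-- The flow of the scalar equation whose logarithmic time scale is given by `H`. -/
def scalarFlow (H : ℝ ≃o ℝ) (r t : ℝ) : ℝ :=
  -- With `u = log y` and `H' = k`, the equation `y' = -y / k(log y)` reads `(H u)' = -1`. Time runs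
  -- at half speed to leave room for a strict comparison.
  if r ≤ 0 then 0 else Real.exp (H.symm (H (Real.log r) - t / 2))

theorem scalarFlow_of_pos (H : ℝ ≃o ℝ) {r : ℝ} (hr : 0 < r) (t : ℝ) :
    scalarFlow H r t = Real.exp (H.symm (H (Real.log r) - t / 2)) := if_neg hr.not_ge

theorem scalarFlow_nonneg (H : ℝ ≃o ℝ) (r t : ℝ) : 0 ≤ scalarFlow H r t := by
  unfold scalarFlow
  split_ifs
  · exact le_rfl
  · exact (Real.exp_pos _).le

/-- Gives joint continuity at `r = 0` by squeezing, where the logarithmic formula is unavailable. -/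
theorem scalarFlow_le (H : ℝ ≃o ℝ) {r t : ℝ} (hr : 0 ≤ r) (ht : 0 ≤ t) :
    scalarFlow H r t ≤ r := by
  rcases hr.eq_or_lt with rfl | hr
  · simp [scalarFlow]
  · rw [scalarFlow_of_pos H hr, ← Real.le_log_iff_exp_le hr, ← H.le_iff_le, H.apply_symm_apply]
    linarith

theorem isClassKL_scalarFlow (H : ℝ ≃o ℝ) : IsClassKL (scalarFlow H) where
  continuousOn := by
    rintro ⟨r, t⟩ ⟨hr, ht⟩
    rcases (Set.mem_Ici.1 hr).eq_or_lt with rfl | hr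
    · have h0 : Function.uncurry (scalarFlow H) ((0 : ℝ), t) = 0 := by simp [scalarFlow]
      rw [ContinuousWithinAt, h0]
      refine tendsto_of_tendsto_of_tendsto_of_le_of_le' tendsto_const_nhds
        (continuous_fst.continuousWithinAt (s := Set.Ici (0 : ℝ) ×ˢ Set.Ici (0 : ℝ))
          (x := ((0 : ℝ), t))) ?_ ?_
      · exact Eventually.of_forall fun p => scalarFlow_nonneg H _ _
      · filter_upwards [self_mem_nhdsWithin] with p hp
        exact scalarFlow_le H hp.1 hp.2
    · apply ContinuousAt.continuousWithinAt
      have hev : Function.uncurry (scalarFlow H) =ᶠ[𝓝 (r, t)]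
          fun p => Real.exp (H.symm (H (Real.log p.1) - p.2 / 2)) := by
        filter_upwards [continuous_fst.continuousAt.eventually (lt_mem_nhds hr)] with p hp
        exact scalarFlow_of_pos H hp _
      refine ContinuousAt.congr ?_ hev.symm
      have hlog : ContinuousAt (fun p : ℝ × ℝ => Real.log p.1) (r, t) :=
        continuousAt_fst.log hr.ne'
      exact Real.continuous_exp.continuousAt.comp (H.symm.continuous.continuousAt.comp
        ((H.continuous.continuousAt.comp hlog).sub (continuousAt_snd.div_const 2)))
  map_zero := fun t _ => by simp [scalarFlow]
  strictMonoOn := by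
    intro t _ a ha b hb hab
    have hb0 : 0 < b := (Set.mem_Ici.1 ha).trans_lt hab
    simp only [scalarFlow_of_pos H hb0]
    rcases (Set.mem_Ici.1 ha).eq_or_lt with rfl | ha
    · simpa [scalarFlow] using Real.exp_pos _
    · rw [scalarFlow_of_pos H ha, Real.exp_lt_exp, H.symm.lt_iff_lt]
      have := H.strictMono (Real.log_lt_log ha hab)
      linarith
  antitoneOn := by
    intro s hs a _ b _ hab
    rcases hs.eq_or_lt with rfl | hs
    · simp [scalarFlow]
    · rw [scalarFlow_of_pos H hs, scalarFlow_of_pos H hs, Real.exp_le_exp, H.symm.le_iff_le]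
      linarith
  tendsto_zero := by
    intro s hs
    rcases hs.eq_or_lt with rfl | hs
    · have : scalarFlow H 0 = fun _ => 0 := funext fun t => by simp [scalarFlow]
      rw [this]
      exact tendsto_const_nhds
    · have : scalarFlow H s = fun t => Real.exp (H.symm (H (Real.log s) - t / 2)) :=
        funext fun t => scalarFlow_of_pos H hs t
      rw [this]
      refine Real.tendsto_exp_atBot.comp (H.symm.tendsto_atBot.comp ?_)
      exact tendsto_atBot_add_const_left _ _
        (tendsto_neg_atTop_atBot.comp (tendsto_id.atTop_div_const two_pos))

/-- Every decay rate yields a comparison function of class `KL` that bounds the nonnegative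
functions decaying with at least this rate. -/
theorem exists_isClassKL_of_rate {k : ℝ → ℝ} (hk : Continuous k) (hk1 : ∀ v, 1 ≤ k v) :
    ∃ β : ℝ → ℝ → ℝ, IsClassKL β ∧ ∀ T : ℝ, 0 ≤ T → ∀ y φ : ℝ → ℝ,
      ContinuousOn y (Set.Icc 0 T) → ContinuousOn φ (Set.Icc 0 T) →
      (∀ s ∈ Set.Icc 0 T, 0 < y s) →
      (∀ s₁ s₂, 0 ≤ s₁ → s₁ ≤ s₂ → s₂ ≤ T → y s₂ - y s₁ ≤ -∫ s in s₁..s₂, φ s) →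
      (∀ s ∈ Set.Icc 0 T, y s ≤ k (Real.log (y s)) * φ s) → y T ≤ β (y 0) T := by
  obtain ⟨H, hH⟩ := exists_orderIso_hasDerivAt hk hk1
  refine ⟨scalarFlow H, isClassKL_scalarFlow H, ?_⟩
  intro T hT y φ hy hφ hpos hint hrate
  have hy0 : 0 < y 0 := hpos 0 ⟨le_rfl, hT⟩
  rw [scalarFlow_of_pos H hy0]
  set u : ℝ → ℝ := fun t => H.symm (H (Real.log (y 0)) - t / 2) with hu
  have hkpos : ∀ v, 0 < k v := fun v => zero_lt_one.trans_le (hk1 v)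
  have hud : ∀ t, HasDerivAt u ((k (u t))⁻¹ * (-(1 / 2))) t := by
    intro t
    have h1 : HasDerivAt H.symm (k (u t))⁻¹ (H (Real.log (y 0)) - t / 2) :=
      HasDerivAt.of_local_left_inverse H.symm.continuous.continuousAt (hH _) (hkpos _).ne'
        (Eventually.of_forall H.apply_symm_apply)
    exact h1.comp t (by simpa using ((hasDerivAt_id t).div_const 2).const_sub (H (Real.log (y 0))))
  have hBd : ∀ t, HasDerivAt (fun t => Real.exp (u t))
      (Real.exp (u t) * ((k (u t))⁻¹ * (-(1 / 2)))) t := fun t => (hud t).exp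
  refine image_le_of_liminf_slope_right_lt_deriv_boundary' (f := y) (f' := fun t => -φ t) hy ?_
    (B := fun t => Real.exp (u t)) ?_ (fun t _ => (hBd t).continuousAt.continuousWithinAt)
    (fun t _ => (hBd t).hasDerivWithinAt) ?_ ⟨hT, le_rfl⟩
  · intro x hx r hr
    refine Eventually.frequently ?_
    obtain ⟨r', hr1, hr2⟩ := exists_between hr
    have hφx : ContinuousWithinAt φ (Set.Icc x T) x :=
      (hφ x ⟨hx.1, hx.2.le⟩).mono (Set.Icc_subset_Icc_left hx.1)
    -- Near `x` on the right `φ > -r'`, so the integral inequality bounds the slope of `y` by `r' <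
    -- r`.
    have hev : ∀ᶠ z in 𝓝[>] x, ∀ w ∈ Set.Icc x z, -r' < φ w ∧ w ≤ T := by
      have h1 : ∀ᶠ w in 𝓝[≥] x, -r' < φ w ∧ w ≤ T := by
        rw [← nhdsWithin_Icc_eq_nhdsGE hx.2]
        filter_upwards [hφx.eventually (lt_mem_nhds (neg_lt.1 hr1)), self_mem_nhdsWithin]
          with w h1 h2 using ⟨h1, h2.2⟩
      obtain ⟨c, hc, hsub⟩ := (mem_nhdsGE_iff_exists_Ico_subset).1 h1
      filter_upwards [Ioo_mem_nhdsGT hc] with z hz w hw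
      exact hsub ⟨hw.1, hw.2.trans_lt hz.2⟩
    filter_upwards [hev, self_mem_nhdsWithin] with z hz hxz
    have hxz' : x < z := hxz
    have hzT : z ≤ T := (hz z ⟨hxz'.le, le_rfl⟩).2
    have h2 : ∫ _ in x..z, -r' ≤ ∫ s in x..z, φ s := by
      refine intervalIntegral.integral_mono_on hxz'.le (by simp) ?_ fun w hw => (hz w hw).1.le
      refine (hφ.mono ?_).intervalIntegrable
      rw [Set.uIcc_of_le hxz'.le]
      exact Set.Icc_subset_Icc hx.1 hzT
    rw [intervalIntegral.integral_const, smul_eq_mul] at h2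
    have h3 := hint x z hx.1 hxz'.le hzT
    rw [slope_def_field, div_lt_iff₀ (sub_pos.2 hxz')]
    nlinarith [sub_pos.2 hxz']
  · simp [hu, Real.exp_log hy0]
  -- On contact `y` decreases at rate at least `exp u / k(u)`, the barrier at only half of it.
  · intro t ht heq
    have h1 := hrate t ⟨ht.1, ht.2.le⟩
    rw [heq, Real.log_exp] at h1
    have h2 : Real.exp (u t) * (k (u t))⁻¹ ≤ φ t := by
      rw [← div_eq_mul_inv, div_le_iff₀ (hkpos _)]
      linarith
    have h3 : 0 < Real.exp (u t) * (k (u t))⁻¹ := mul_pos (Real.exp_pos _) (inv_pos.2 (hkpos _))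
    have h4 : Real.exp (u t) * ((k (u t))⁻¹ * (-(1 / 2)))
      = -(Real.exp (u t) * (k (u t))⁻¹) / 2 := by ring
    rw [h4]
    linarith

/-- A relation between positive levels `a` and outflows `b` admits a continuous decay rate as soon
as the outflow is bounded away from zero on compact sets of positive levels. -/
theorem exists_rate {D : Set (ℝ × ℝ)}
    (hD : ∀ a b, 0 < a → ∃ c, 0 < c ∧ ∀ p ∈ D, a ≤ p.1 → p.1 ≤ b → c ≤ p.2) :
    ∃ k : ℝ → ℝ, Continuous k ∧ (∀ v, 1 ≤ k v) ∧ ∀ r, 0 < r → ∀ p ∈ D, r ≤ p.1 → p.1 ≤ 2 * r →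
      r ≤ k (Real.log r) * p.2 := by
  have key : ∃ g : C(ℝ, ℝ), ∀ v : ℝ, g v ∈ {c : ℝ | 1 ≤ c ∧ ∀ p ∈ D, Real.exp v ≤ p.1 →
      p.1 ≤ 2 * Real.exp v → Real.exp v ≤ c * p.2} := by
    -- The admissible constants at each `v` form a convex set, so constants that work locally can be
    -- glued continuously.
    refine exists_continuous_forall_mem_convex_of_local_const ?_ ?_
    · intro v c hc d hd a b ha hb hab
      refine ⟨?_, fun p hp h1 h2 => ?_⟩
      · have h3 := hc.1
        have h4 := hd.1
        simp only [smul_eq_mul]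
        nlinarith
      · have h3 := hc.2 p hp h1 h2
        have h4 := hd.2 p hp h1 h2
        simp only [smul_eq_mul]
        calc Real.exp v = a * Real.exp v + b * Real.exp v := by rw [← add_mul, hab, one_mul]
          _ ≤ a * (c * p.2) + b * (d * p.2) := by gcongr
          _ = _ := by ring
    · intro v
      obtain ⟨c, hc, hcD⟩ := hD (Real.exp (v - 1)) (2 * Real.exp (v + 1)) (Real.exp_pos _)
      refine ⟨1 + Real.exp (v + 1) / c, ?_⟩
      filter_upwards [Ioo_mem_nhds (sub_one_lt v) (lt_add_one v)] with w hw
      have hw1 := Real.exp_le_exp.2 hw.1.le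
      have hw2 := Real.exp_le_exp.2 hw.2.le
      refine ⟨by have := Real.exp_pos (v + 1); simp only [le_add_iff_nonneg_right]; positivity,
        fun p hp h1 h2 => ?_⟩
      have h3 := hcD p hp (hw1.trans h1) (h2.trans (by linarith))
      calc Real.exp w ≤ Real.exp (v + 1) / c * c := by rwa [div_mul_cancel₀ _ hc.ne']
        _ ≤ Real.exp (v + 1) / c * p.2 := by gcongr
        _ ≤ (1 + Real.exp (v + 1) / c) * p.2 := by nlinarith
  obtain ⟨g, hg⟩ := key
  refine ⟨g, g.continuous, fun v => (hg v).1, fun r hr p hp h1 h2 => ?_⟩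
  have := (hg (Real.log r)).2 p hp
  rw [Real.exp_log hr] at this
  exact this h1 h2

/-! ### Scalar balance equations -/

/-- The level `v` changes by the inflow `A` and the outflow `p`, where level and outflow are related
by `D`. -/
structure IsScalarBalance (D : Set (ℝ × ℝ)) (A v p : ℝ → ℝ) : Prop where
  mem : ∀ t, 0 ≤ t → (v t, p t) ∈ D
  continuousOn_level : ContinuousOn v (Set.Ici 0)
  continuousOn_outflow : ContinuousOn p (Set.Ici 0)
  inflow_nonneg : ∀ t, 0 ≤ t → 0 ≤ A t
  intervalIntegrable : ∀ t, 0 ≤ t → IntervalIntegrable A volume 0 t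
  eq_integral : ∀ t, 0 ≤ t → v t = v 0 + ∫ s in (0 : ℝ)..t, (A s - p s)

namespace IsScalarBalance

variable {D : Set (ℝ × ℝ)} {A v p : ℝ → ℝ}

theorem intervalIntegrable_inflow (h : IsScalarBalance D A v p) {s t : ℝ} (hs : 0 ≤ s)
    (ht : 0 ≤ t) : IntervalIntegrable A volume s t :=
  (h.intervalIntegrable s hs).symm.trans (h.intervalIntegrable t ht)

theorem intervalIntegrable_outflow (h : IsScalarBalance D A v p) {s t : ℝ} (hs : 0 ≤ s)
    (ht : 0 ≤ t) : IntervalIntegrable p volume s t :=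
  (h.continuousOn_outflow.mono fun _ hx => (le_min hs ht).trans hx.1).intervalIntegrable

theorem sub_eq (h : IsScalarBalance D A v p) {s t : ℝ} (hs : 0 ≤ s) (ht : 0 ≤ t) :
    v t - v s = (∫ τ in s..t, A τ) - ∫ τ in s..t, p τ := by
  have hA {r : ℝ} (hr : 0 ≤ r) := h.intervalIntegrable_inflow le_rfl hr
  have hp {r : ℝ} (hr : 0 ≤ r) := h.intervalIntegrable_outflow le_rfl hr
  rw [h.eq_integral t ht, h.eq_integral s hs, intervalIntegral.integral_sub (hA ht) (hp ht),
    intervalIntegral.integral_sub (hA hs) (hp hs),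
    ← intervalIntegral.integral_interval_sub_left (hA ht) (hA hs),
    ← intervalIntegral.integral_interval_sub_left (hp ht) (hp hs)]
  ring

theorem integral_inflow_nonneg (h : IsScalarBalance D A v p) {s t : ℝ} (hs : 0 ≤ s) (hst : s ≤ t) :
    0 ≤ ∫ τ in s..t, A τ :=
  intervalIntegral.integral_nonneg hst fun _ hu => h.inflow_nonneg _ (hs.trans hu.1)

theorem integral_inflow_mono (h : IsScalarBalance D A v p) {s t : ℝ} (hs : 0 ≤ s) (hst : s ≤ t) :
    ∫ τ in (0 : ℝ)..s, A τ ≤ ∫ τ in (0 : ℝ)..t, A τ := by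
  have h1 := h.integral_inflow_nonneg hs hst
  rw [← intervalIntegral.integral_interval_sub_left (h.intervalIntegrable t (hs.trans hst))
    (h.intervalIntegrable s hs)] at h1
  linarith

end IsScalarBalance

/-- The outflow is nonnegative, and bounded away from zero on compact sets of positive levels. -/
structure IsPositiveOutflow (D : Set (ℝ × ℝ)) : Prop where
  level_nonneg : ∀ p ∈ D, 0 ≤ p.1
  outflow_nonneg : ∀ p ∈ D, 0 ≤ p.2
  exists_lower_bound : ∀ a b, 0 < a → ∃ c, 0 < c ∧ ∀ p ∈ D, a ≤ p.1 → p.1 ≤ b → c ≤ p.2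

/-- Integral input-to-state stability of scalar balance equations. -/
theorem IsPositiveOutflow.exists_iISS_bound {D : Set (ℝ × ℝ)} (hD : IsPositiveOutflow D) :
    ∃ β, IsClassKL β ∧ ∀ A v p, IsScalarBalance D A v p → ∀ t, 0 ≤ t →
      v t ≤ β (v 0) t + 2 * ∫ s in (0 : ℝ)..t, A s := by
  obtain ⟨k, hk, hk1, hkD⟩ := exists_rate hD.exists_lower_bound
  obtain ⟨β, hβ, hβ'⟩ := exists_isClassKL_of_rate hk hk1
  refine ⟨β, hβ, fun A v p h t ht => ?_⟩
  set c : ℝ → ℝ := fun s => ∫ τ in (0 : ℝ)..s, A τ with hc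
  have hc0 : ∀ s, 0 ≤ s → 0 ≤ c s := fun s hs => h.integral_inflow_nonneg le_rfl hs
  have hv0 : 0 ≤ v 0 := hD.level_nonneg _ (h.mem 0 le_rfl)
  set w : ℝ → ℝ := fun s => v s - c s with hw
  have hwsub : ∀ s₁ s₂, 0 ≤ s₁ → s₁ ≤ s₂ → w s₂ - w s₁ = -∫ s in s₁..s₂, p s := by
    intro s₁ s₂ h1 h2
    have h3 := h.sub_eq h1 (h1.trans h2)
    rw [← intervalIntegral.integral_interval_sub_left (h.intervalIntegrable s₂ (h1.trans h2))
      (h.intervalIntegrable s₁ h1)] at h3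
    simp only [hw, hc]
    linarith
  -- As `w` is nonincreasing, either it has dropped to `c t`, whence `v t ≤ 2 * c t`, or it stays
  -- above `c t ≥ c s` throughout `[0, t]`, so that `w ≤ v ≤ 2w` and the decay rate applies to `w`.
  by_cases hcase : ∃ s ∈ Set.Icc 0 t, w s ≤ c t
  · obtain ⟨s, hs, hsw⟩ := hcase
    have h1 := hwsub s t hs.1 hs.2
    have h2 : 0 ≤ ∫ τ in s..t, p τ := intervalIntegral.integral_nonneg hs.2 fun u hu =>
      hD.outflow_nonneg _ (h.mem u (hs.1.trans hu.1))
    have h3 : v t = w t + c t := by simp [hw]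
    have h4 := hβ.nonneg hv0 ht
    change v t ≤ β (v 0) t + 2 * c t
    linarith
  · push Not at hcase
    have h1 := hβ' t ht w p ?_ (h.continuousOn_outflow.mono fun s hs => hs.1) ?_ ?_ ?_
    · have h2 : w 0 = v 0 := by simp [hw, hc]
      have h3 : v t = w t + c t := by simp [hw]
      have h4 := hc0 t ht
      rw [h2] at h1
      change v t ≤ β (v 0) t + 2 * c t
      linarith
    · refine (h.continuousOn_level.mono fun s hs => hs.1).sub ?_
      have := intervalIntegral.continuousOn_primitive_interval (μ := volume) (f := A) (a := 0)
        (b := t) (by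
          rw [Set.uIcc_of_le ht, ← intervalIntegrable_iff_integrableOn_Icc_of_le ht]
          exact h.intervalIntegrable t ht)
      rwa [Set.uIcc_of_le ht] at this
    · exact fun s hs => (hc0 t ht).trans_lt (hcase s hs)
    · exact fun s₁ s₂ h1 h2 _ => (hwsub s₁ s₂ h1 h2).le
    · intro s hs
      have h2 : v s = w s + c s := by simp [hw]
      have h3 := hc0 s hs.1
      have h4 : c s ≤ c t := h.integral_inflow_mono hs.1 hs.2
      have h5 := hcase s hs
      exact hkD (w s) ((hc0 t ht).trans_lt h5) _ (h.mem s hs.1) (by simp only; linarith)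
        (by simp only; linarith)

/-- Input-to-state stability of scalar balance equations with a bounded inflow, given the levels
`μ c` above which the outflow exceeds the inflow `c`. -/
theorem IsPositiveOutflow.exists_ISS_bound {D : Set (ℝ × ℝ)} (hD : IsPositiveOutflow D)
    {μ : ℝ → ℝ} {S : Set ℝ} (hμ : IsClassKInf μ) (hS : ∀ c ∈ S, 0 ≤ c)
    (hgain : ∀ c ∈ S, ∀ q ∈ D, μ c ≤ q.1 → c * (1 + q.1) ≤ q.2 * q.1) :
    ∃ β, IsClassKL β ∧ ∀ A v p, IsScalarBalance D A v p → ∀ c ∈ S,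
      (∀ᵐ t ∂(volume.restrict (Set.Ici 0)), A t ≤ c) → ∀ t, 0 ≤ t → v t ≤ β (v 0) t + μ c := by
  -- The rate is built for the reduced outflow `p / (1 + v)`, a lower bound of `p - c` above level
  -- `μ c` whatever `c` is.
  obtain ⟨k, hk, hk1, hkD⟩ := exists_rate
    (D := (fun q : ℝ × ℝ => (q.1, q.2 / (1 + q.1))) '' D) (by
      intro a b ha
      obtain ⟨c, hc, hcD⟩ := hD.exists_lower_bound a b ha
      refine ⟨c / (1 + max a b), by have := ha.trans_le (le_max_left a b); positivity, ?_⟩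
      rintro _ ⟨q, hq, rfl⟩ h1 h2
      have h3 := hcD q hq h1 h2
      have h4 := hD.level_nonneg q hq
      have h5 : q.1 ≤ max a b := h2.trans (le_max_right a b)
      exact div_le_div₀ (hc.le.trans h3) h3 (by linarith) (by linarith))
  obtain ⟨β, hβ, hβ'⟩ := exists_isClassKL_of_rate hk hk1
  refine ⟨β, hβ, fun A v p h c hc hA t ht => ?_⟩
  have hc0 := hS c hc
  have hμ0 : 0 ≤ μ c := hμ.nonneg hc0
  have hv0 : 0 ≤ v 0 := hD.level_nonneg _ (h.mem 0 le_rfl)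
  have hint : ∀ s₁ s₂, 0 ≤ s₁ → s₁ ≤ s₂ → v s₂ - v s₁ ≤ -∫ s in s₁..s₂, (p s - c) := by
    intro s₁ s₂ h1 h2
    rw [h.sub_eq h1 (h1.trans h2), intervalIntegral.integral_sub
      (h.intervalIntegrable_outflow h1 (h1.trans h2)) (by simp)]
    have : ∫ τ in s₁..s₂, A τ ≤ ∫ _ in s₁..s₂, c :=
      intervalIntegral.integral_mono_ae_restrict h2
        (h.intervalIntegrable_inflow h1 (h1.trans h2)) (by simp)
        (ae_restrict_of_ae_restrict_of_subset
          (fun x hx => Set.mem_Ici.2 (h1.trans hx.1)) hA)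
    linarith
  by_cases hcase : ∃ s ∈ Set.Icc 0 t, v s ≤ μ c
  · have hvt : v t ≤ μ c := by
      by_contra hvt
      have hcl : IsCompact {s ∈ Set.Icc 0 t | v s ≤ μ c} :=
        isCompact_Icc.of_isClosed_subset
          ((h.continuousOn_level.mono fun s hs => hs.1).preimage_isClosed_of_isClosed
            isClosed_Icc (isClosed_Iic (a := μ c))) fun s hs => hs.1
      -- After the last time `s` with `v s ≤ μ c` the outflow is at least `c`, so the level cannot
      -- have risen.
      obtain ⟨s, ⟨hs, hsv⟩, hmax⟩ := hcl.exists_isGreatest hcase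
      have hle : 0 ≤ ∫ τ in s..t, (p τ - c) := by
        refine intervalIntegral.integral_nonneg_of_ae_restrict hs.2 ?_
        rw [← restrict_Ioc_eq_restrict_Icc]
        filter_upwards [ae_restrict_mem measurableSet_Ioc] with τ hτ
        have h0 : 0 ≤ τ := hs.1.trans hτ.1.le
        have h1 : μ c < v τ := by
          by_contra hlt
          exact hτ.1.not_ge (hmax ⟨⟨h0, hτ.2⟩, not_lt.1 hlt⟩)
        have h2 := hgain c hc _ (h.mem τ h0) h1.le
        have h3 : 0 < v τ := hμ0.trans_lt h1
        simp only [Pi.zero_apply] at h2 ⊢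
        have h4 : c * v τ ≤ p τ * v τ := by linarith
        linarith [le_of_mul_le_mul_right h4 h3]
      have := hint s t hs.1 hs.2
      linarith
    linarith [hβ.nonneg hv0 ht]
  · push Not at hcase
    have hpos : ∀ s ∈ Set.Icc 0 t, 0 < v s := fun s hs => hμ0.trans_lt (hcase s hs)
    have h1 := hβ' t ht v (fun s => p s - c) (h.continuousOn_level.mono fun s hs => hs.1)
      ((h.continuousOn_outflow.mono fun s hs => hs.1).sub continuousOn_const) hpos
      (fun s₁ s₂ h1 h2 _ => hint s₁ s₂ h1 h2) ?_
    · linarith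
    · intro s hs
      have hvs := hpos s hs
      have h2 := hgain c hc _ (h.mem s hs.1) (hcase s hs).le
      have h3 := hkD (v s) hvs _ ⟨_, h.mem s hs.1, rfl⟩ le_rfl (by simp only; linarith)
      refine h3.trans (mul_le_mul_of_nonneg_left ?_ (zero_le_one.trans (hk1 _)))
      simp only at h2 ⊢
      rw [div_le_iff₀ (by linarith)]
      nlinarith

/-! ### Gain functions -/

theorem exists_isClassKInf_inverse {ν : ℝ → ℝ} (hc : Continuous ν)
    (hm : StrictMonoOn ν (Set.Ici 0)) (h0 : ν 0 = 0) (ht : Tendsto ν atTop atTop) :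
    ∃ μ, IsClassKInf μ ∧ ∀ c r, 0 ≤ c → 0 ≤ r → μ c ≤ r → c ≤ ν r := by
  -- Continuing `ν` by the identity on the negative axis gives an order isomorphism of the whole
  -- line.
  set e : ℝ → ℝ := fun r => ν (max r 0) + min r 0 with he
  have hec : Continuous e := by fun_prop
  have hem : StrictMono e := by
    intro a b hab
    rcases le_or_gt 0 a with ha | ha
    · have hb := ha.trans hab.le
      simpa [he, ha, hb] using hm ha hb hab
    · have h1 : ν (max a 0) ≤ ν (max b 0) :=
        hm.monotoneOn (Set.mem_Ici.2 (le_max_right _ _))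
        (Set.mem_Ici.2 (le_max_right _ _)) (max_le_max_right 0 hab.le)
      have h2 : min a 0 < min b 0 := by
        rw [min_eq_left ha.le]
        exact lt_min hab ha
      exact add_lt_add_of_le_of_lt h1 h2
  have hpos : ∀ r, 0 ≤ r → e r = ν r := fun r hr => by simp [he, hr]
  have htop : Tendsto e atTop atTop := by
    refine ht.congr' ?_
    filter_upwards [eventually_ge_atTop 0] with r hr using (hpos r hr).symm
  have hbot : Tendsto e atBot atBot := by
    refine tendsto_id.congr' ?_
    filter_upwards [eventually_le_atBot 0] with r hr
    simp [he, hr, h0]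
  let H : ℝ ≃o ℝ := hem.orderIsoOfSurjective e (hec.surjective htop hbot)
  have hH : ∀ r, H r = e r := fun r => rfl
  refine ⟨H.symm, ⟨H.symm.continuous.continuousOn, H.symm.strictMono.strictMonoOn _, ?_,
    H.symm.tendsto_atTop⟩, fun c r hc hr h => ?_⟩
  · rw [H.symm_apply_eq, hH, hpos 0 le_rfl, h0]
  · rw [← hpos r hr, ← hH]
    exact H.symm_apply_le.1 h

/-- A nondecreasing continuous minorant of the outflow as a function of the level. -/
theorem IsPositiveOutflow.exists_monotone_minorant {D : Set (ℝ × ℝ)} (hD : IsPositiveOutflow D)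
    (h0 : ((0 : ℝ), (0 : ℝ)) ∈ D)
    {C K : ℝ} (hC : 0 < C) (hCK : ∀ p ∈ D, K ≤ p.1 → C ≤ p.2) :
    ∃ ν : ℝ → ℝ, Continuous ν ∧ MonotoneOn ν (Set.Ici 0) ∧ (∀ r, 0 < r → 0 < ν r) ∧
      (∀ p ∈ D, ν p.1 ≤ p.2) ∧
      ∀ C' K' : ℝ, (∀ p ∈ D, K' ≤ p.1 → C' ≤ p.2) → ∀ r, K' + C' ≤ r → C' ≤ ν r := by
  have : Nonempty D := ⟨⟨_, h0⟩⟩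
  -- Infimal convolution: a pair whose level lies below `r` pays the shortfall. The infimum is
  -- monotone and 1-Lipschitz in `r`, and stays positive since low levels pay at least `r / 2`.
  set g : ℝ → D → ℝ := fun r q => q.1.2 + max (r - q.1.1) 0 with hg
  set ν : ℝ → ℝ := fun r => ⨅ q : D, g r q with hν
  have hbdd : ∀ r, BddBelow (Set.range (g r)) := fun r => ⟨0, by
    rintro _ ⟨q, rfl⟩
    exact add_nonneg (hD.outflow_nonneg _ q.2) (le_max_right _ _)⟩
  have hmono : Monotone ν := fun a b hab => ciInf_mono (hbdd a) fun q => by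
    simp only [hg]
    gcongr
  have hlip : ∀ a b, ν a ≤ ν b + |a - b| := by
    intro a b
    rw [← sub_le_iff_le_add]
    refine le_ciInf fun q => ?_
    have h1 : ν a ≤ g a q := ciInf_le (hbdd a) q
    have h2 : max (a - q.1.1) 0 ≤ max (b - q.1.1) 0 + |a - b| := by
      refine max_le ?_ (add_nonneg (le_max_right _ _) (abs_nonneg _))
      have := le_max_left (b - q.1.1) 0
      linarith [le_abs_self (a - b)]
    simp only [hg] at h1 ⊢
    linarith
  refine ⟨ν, ?_, hmono.monotoneOn _, ?_, ?_, ?_⟩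
  · refine (LipschitzWith.of_le_add (f := ν) fun a b => ?_).continuous
    rw [Real.dist_eq]
    exact hlip a b
  · intro r hr
    obtain ⟨c, hc, hcD⟩ := hD.exists_lower_bound (r / 2) K (by linarith)
    refine (lt_min (lt_min hc hC) (half_pos hr)).trans_le (le_ciInf fun q => ?_)
    have hq := hD.outflow_nonneg _ q.2
    have h1 := le_max_left (r - q.1.1) 0
    have h2 := le_max_right (r - q.1.1) 0
    simp only [hg]
    rcases le_total q.1.1 (r / 2) with h | h
    · exact (min_le_right _ _).trans (by linarith)
    · refine (min_le_left _ _).trans ?_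
      rcases le_total q.1.1 K with h' | h'
      · exact (min_le_left _ _).trans (by linarith [hcD _ q.2 h h'])
      · exact (min_le_right _ _).trans (by linarith [hCK _ q.2 h'])
  · intro p hp
    have := ciInf_le (hbdd p.1) ⟨p, hp⟩
    simpa [hg] using this
  · intro C' K' h r hr
    refine le_ciInf fun q => ?_
    have hq := hD.outflow_nonneg _ q.2
    have h1 := le_max_left (r - q.1.1) 0
    have h2 := le_max_right (r - q.1.1) 0
    simp only [hg]
    rcases le_total K' q.1.1 with h' | h'
    · linarith [h _ q.2 h']
    · linarith

/-- The factor `r / (1 + r)` makes a monotone minorant strictly increasing and produces the form `c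
* (1 + v) ≤ p * v` of the gain condition. The absolute value keeps the denominator positive on all
of `ℝ`. -/
theorem strictMonoOn_mul_div_one_add {ν : ℝ → ℝ} (hm : MonotoneOn ν (Set.Ici 0))
    (hpos : ∀ r, 0 < r → 0 < ν r) :
    StrictMonoOn (fun r => ν r * (r / (1 + |r|))) (Set.Ici 0) := by
  intro a ha b hb hab
  have ha' : 0 ≤ a := ha
  have hb' : 0 < b := ha'.trans_lt hab
  simp only [abs_of_nonneg ha', abs_of_pos hb']
  have h1 : a / (1 + a) < b / (1 + b) := by
    rw [div_lt_div_iff₀ (by linarith) (by linarith)]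
    linarith
  calc ν a * (a / (1 + a)) ≤ ν b * (a / (1 + a)) :=
        mul_le_mul_of_nonneg_right (hm ha hb hab.le) (by positivity)
    _ < ν b * (b / (1 + b)) := mul_lt_mul_of_pos_left h1 (hpos b hb')

/-- If the outflow exceeds `C > U` at high levels, then there is a gain function for the inflows
bounded by `U`. -/
theorem IsPositiveOutflow.exists_gain {D : Set (ℝ × ℝ)} (hD : IsPositiveOutflow D)
    (h0 : ((0 : ℝ), (0 : ℝ)) ∈ D) {U C K : ℝ} (hU : 0 ≤ U) (hUC : U < C)
    (hCK : ∀ p ∈ D, K ≤ p.1 → C ≤ p.2) :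
    ∃ μ, IsClassKInf μ ∧ ∀ c ∈ Set.Icc 0 U, ∀ q ∈ D, μ c ≤ q.1 → c * (1 + q.1) ≤ q.2 * q.1 := by
  obtain ⟨ν, hνc, hνm, hνpos, hνD, hνC⟩ := hD.exists_monotone_minorant h0 (hU.trans_lt hUC) hCK
  -- Beyond `K + C` the minorant is at least `C`, and `C * r / (1 + r) ≥ U` once `r ≥ U / (C - U)`.
  set r₁ : ℝ := max (K + C) (U / (C - U)) with hr₁
  have hr₁U : U / (C - U) ≤ r₁ := le_max_right _ _
  have hr₁0 : 0 ≤ r₁ := (div_nonneg hU (sub_pos.2 hUC).le).trans hr₁U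
  have hcont : Continuous fun r : ℝ => ν r * (r / (1 + |r|)) :=
    hνc.mul (continuous_id.div (by fun_prop) fun r => by positivity)
  have hlarge : ∀ r, r₁ ≤ r → U ≤ ν r * (r / (1 + |r|)) := by
    intro r hr
    have hr0 := hr₁0.trans hr
    have h1 := hνC C K hCK r ((le_max_left _ _).trans hr)
    rw [abs_of_nonneg hr0, ← mul_div_assoc, le_div_iff₀ (by linarith)]
    have h2 := hr₁U.trans hr
    rw [div_le_iff₀ (sub_pos.2 hUC)] at h2
    nlinarith
  -- The added term makes the function unbounded. It vanishes up to `r₁`, and beyond `r₁` the gain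
  -- condition holds for every `c ≤ U` anyway.
  obtain ⟨μ, hμ, hμν⟩ := exists_isClassKInf_inverse
    (ν := fun r => ν r * (r / (1 + |r|)) + max (r - r₁) 0)
    (hcont.add (by fun_prop))
    ((strictMonoOn_mul_div_one_add hνm hνpos).add_monotone
      (fun a _ b _ hab => max_le_max_right 0 (by linarith)))
    (by simp [hr₁0])
    (by
      refine tendsto_atTop_mono' _ ?_ (tendsto_atTop_add_const_right _ (-r₁) tendsto_id)
      filter_upwards [eventually_ge_atTop r₁] with r hr
      have h1 := hU.trans (hlarge r hr)
      have h2 := le_max_left (r - r₁) 0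
      simp only [id]
      linarith)
  refine ⟨μ, hμ, fun c hc q hq hcq => ?_⟩
  have hq0 := hD.level_nonneg q hq
  have h1 : c ≤ ν q.1 * (q.1 / (1 + q.1)) := by
    have h2 := hμν c q.1 hc.1 hq0 hcq
    rcases le_total q.1 r₁ with h | h
    · rwa [max_eq_right (by linarith), add_zero, abs_of_nonneg hq0] at h2
    · have h3 := hlarge q.1 h
      rw [abs_of_nonneg hq0] at h3
      exact hc.2.trans h3
  rw [← mul_div_assoc, le_div_iff₀ (by linarith)] at h1
  exact h1.trans (mul_le_mul_of_nonneg_right (hνD q hq) hq0)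

/-- If the outflow tends to infinity with the level, then there is a gain function for all bounded
inflows. -/
theorem IsPositiveOutflow.exists_gain_of_unbounded {D : Set (ℝ × ℝ)} (hD : IsPositiveOutflow D)
    (h0 : ((0 : ℝ), (0 : ℝ)) ∈ D) (hCK : ∀ C : ℝ, ∃ K, ∀ p ∈ D, K ≤ p.1 → C ≤ p.2) :
    ∃ μ, IsClassKInf μ ∧ ∀ c ∈ Set.Ici (0 : ℝ), ∀ q ∈ D, μ c ≤ q.1 →
      c * (1 + q.1) ≤ q.2 * q.1 := by
  obtain ⟨K, hK⟩ := hCK 1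
  obtain ⟨ν, hνc, hνm, hνpos, hνD, hνC⟩ := hD.exists_monotone_minorant h0 one_pos hK
  obtain ⟨μ, hμ, hμν⟩ := exists_isClassKInf_inverse (ν := fun r => ν r * (r / (1 + |r|)))
    (hνc.mul (continuous_id.div (by fun_prop) fun r => by positivity))
    (strictMonoOn_mul_div_one_add hνm hνpos) (by simp)
    (by
      refine tendsto_atTop.2 fun b => ?_
      -- The factor `2` offsets `r / (1 + r) ≥ 1 / 2` for `r ≥ 1`.
      obtain ⟨K', hK'⟩ := hCK (2 * |b|)
      filter_upwards [eventually_ge_atTop (K' + 2 * |b|), eventually_ge_atTop 1] with r h1 h2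
      have h3 := hνC _ _ hK' r h1
      have h4 := le_abs_self b
      have h5 := abs_nonneg b
      rw [abs_of_nonneg (by linarith), ← mul_div_assoc, le_div_iff₀ (by linarith)]
      nlinarith)
  refine ⟨μ, hμ, fun c hc q hq hcq => ?_⟩
  have hq0 := hD.level_nonneg q hq
  have h1 := hμν c q.1 hc hq0 hcq
  rw [abs_of_nonneg hq0, ← mul_div_assoc, le_div_iff₀ (by linarith)] at h1
  exact h1.trans (mul_le_mul_of_nonneg_right (hνD q hq) hq0)

/-! ### Routing matrices -/

section Routing

variable {E : Type*} [Fintype E] [DecidableEq E] {R : Matrix E E ℝ}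

/-- A minimum principle for routing matrices. -/
theorem IsRoutingMatrix.nonneg_of_mulVec_nonneg (hR : IsRoutingMatrix R) (hconn : OutflowConnected R)
    {v : E → ℝ} (hv : 0 ≤ (1 - R).mulVec v) : 0 ≤ v := by
  rcases isEmpty_or_nonempty E with hE | hE
  · intro i
    exact hE.elim i
  obtain ⟨i₀, hi₀⟩ := Finite.exists_min v
  by_contra hneg
  have hm : v i₀ < 0 := by
    by_contra hm
    exact hneg fun i => (not_lt.1 hm).trans (hi₀ i)
  -- At a negative minimum the right side is nonpositive and the terms on the left are nonnegative,
  -- so the minimum spreads along positive entries of `R`. At a link with row sum below `1` the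
  -- right side is negative, a contradiction.
  have hkey : ∀ i, v i = v i₀ → ∑ j, R i j * (v j - v i₀) ≤ v i₀ * (1 - ∑ j, R i j) := by
    intro i hi
    have h := hv i
    rw [Matrix.sub_mulVec, Matrix.one_mulVec, Pi.sub_apply, hi, Pi.zero_apply, Matrix.mulVec,
      dotProduct] at h
    simp only [mul_sub, Finset.sum_sub_distrib, ← Finset.sum_mul]
    linarith
  have hterm : ∀ i j, 0 ≤ R i j * (v j - v i₀) := fun i j =>
    mul_nonneg (hR.nonneg i j) (sub_nonneg.2 (hi₀ j))
  have hstep : ∀ i j, v i = v i₀ → 0 < R i j → v j = v i₀ := by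
    intro i j hi hij
    have h1 := hkey i hi
    have h2 : v i₀ * (1 - ∑ j, R i j) ≤ 0 :=
      mul_nonpos_of_nonpos_of_nonneg hm.le (sub_nonneg.2 (hR.row_sum_le_one i))
    have h3 := Finset.single_le_sum (f := fun j => R i j * (v j - v i₀)) (fun j _ => hterm i j)
      (Finset.mem_univ j)
    have h4 : R i j * (v j - v i₀) = 0 := le_antisymm (h3.trans (h1.trans h2)) (hterm i j)
    rcases mul_eq_zero.1 h4 with h | h
    · exact absurd h hij.ne'
    · linarith
  obtain ⟨j, hpath, hj⟩ := hconn i₀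
  have hvj : v j = v i₀ := by
    clear hj
    induction hpath with
    | refl => rfl
    | tail hab hbc ih => exact hstep _ _ ih hbc
  have h1 := hkey j hvj
  have h2 : 0 ≤ ∑ k, R j k * (v k - v i₀) := Finset.sum_nonneg fun k _ => hterm j k
  nlinarith

theorem IsRoutingMatrix.isUnit_one_sub (hR : IsRoutingMatrix R) (hconn : OutflowConnected R) :
    IsUnit (1 - R) := by
  rw [← Matrix.mulVec_injective_iff_isUnit]
  intro v w hvw
  have h : ∀ a b : E → ℝ, (1 - R).mulVec a = (1 - R).mulVec b → 0 ≤ a - b := fun a b hab =>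
    hR.nonneg_of_mulVec_nonneg hconn (by rw [Matrix.mulVec_sub, hab, sub_self])
  exact le_antisymm (sub_nonneg.1 (h _ _ hvw.symm)) (sub_nonneg.1 (h _ _ hvw))

theorem IsRoutingMatrix.inv_nonneg (hR : IsRoutingMatrix R) (hconn : OutflowConnected R) (i j : E) :
    0 ≤ (1 - R)⁻¹ i j := by
  have hdet := (Matrix.isUnit_iff_isUnit_det _).1 (hR.isUnit_one_sub hconn)
  have h : 0 ≤ (1 - R)⁻¹.mulVec (Pi.single j 1) := hR.nonneg_of_mulVec_nonneg hconn (by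
    rw [Matrix.mulVec_mulVec, Matrix.mul_nonsing_inv _ hdet, Matrix.one_mulVec]
    simp)
  simpa using h i

/-- The inverse `N` satisfies `N = 1 + R N` with `R N ≥ 0`. This yields `‖x‖ ≤ V(x)`. -/
theorem IsRoutingMatrix.one_le_inv_diag (hR : IsRoutingMatrix R) (hconn : OutflowConnected R)
    (i : E) : 1 ≤ (1 - R)⁻¹ i i := by
  have hdet := (Matrix.isUnit_iff_isUnit_det _).1 (hR.isUnit_one_sub hconn)
  have h := congrFun (congrFun (Matrix.mul_nonsing_inv _ hdet) i) i
  rw [Matrix.sub_mul, Matrix.one_mul, Matrix.sub_apply, Matrix.one_apply_eq, Matrix.mul_apply] at h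
  have : 0 ≤ ∑ j, R i j * (1 - R)⁻¹ j i :=
    Finset.sum_nonneg fun j _ => mul_nonneg (hR.nonneg i j) (hR.inv_nonneg hconn j i)
  linarith

end Routing

/-! ### Stability from domination by a scalar balance equation -/

section Domination

variable {E : Type*} [Fintype E]

theorem l1Norm_nonneg (x : E → ℝ) : 0 ≤ l1Norm x := Finset.sum_nonneg fun _ _ => abs_nonneg _

theorem l1Norm_of_nonneg {x : E → ℝ} (hx : 0 ≤ x) : l1Norm x = ∑ i, x i :=
  Finset.sum_congr rfl fun i _ => abs_of_nonneg (hx i)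

theorem continuous_l1Norm : Continuous (l1Norm : (E → ℝ) → ℝ) := by
  unfold l1Norm
  fun_prop

theorem abs_apply_le_l1Norm (x : E → ℝ) (i : E) : |x i| ≤ l1Norm x :=
  Finset.single_le_sum (f := fun i => |x i|) (fun _ _ => abs_nonneg _) (Finset.mem_univ i)

theorem ae_l1Norm_le_of_essSupNorm_lt_top {u : ℝ → E → ℝ} (hu : essSupNorm u < ⊤) :
    ∀ᵐ t ∂(volume.restrict (Set.Ici 0)), l1Norm (u t) ≤ (essSupNorm u).toReal := by
  filter_upwards [ENNReal.ae_le_essSup (μ := volume.restrict (Set.Ici (0 : ℝ)))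
    (fun t => ENNReal.ofReal (l1Norm (u t)))] with t ht
  exact (ENNReal.ofReal_le_iff_le_toReal hu.ne).1 ht

theorem IsInflow.intervalIntegrable {lam : ℝ → E → ℝ} (h : IsInflow lam) {t : ℝ} (ht : 0 ≤ t)
    {g : (E → ℝ) → ℝ} (hg : Continuous g) {M : ℝ} (hM : 0 ≤ M) (hgM : ∀ x, |g x| ≤ M * l1Norm x) :
    IntervalIntegrable (fun s => g (lam s)) volume 0 t := by
  rw [intervalIntegrable_iff_integrableOn_Icc_of_le ht]
  obtain ⟨C, hC⟩ := h.locally_bounded t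
  refine Integrable.of_bound (hg.comp_aestronglyMeasurable
    (h.aestronglyMeasurable.mono_measure (Measure.restrict_mono Set.Icc_subset_Ici_self le_rfl)))
    (M * C) ?_
  filter_upwards [hC] with s hs
  exact (hgM _).trans (mul_le_mul_of_nonneg_left hs hM)

theorem IsInflow.intervalIntegrable_l1Norm {lam : ℝ → E → ℝ} (h : IsInflow lam) {t : ℝ}
    (ht : 0 ≤ t) : IntervalIntegrable (fun s => l1Norm (lam s)) volume 0 t :=
  h.intervalIntegrable ht continuous_l1Norm zero_le_one fun x => by
    rw [one_mul, abs_of_nonneg (l1Norm_nonneg x)]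

theorem IsInflow.intervalIntegrable_apply {lam : ℝ → E → ℝ} (h : IsInflow lam) {t : ℝ}
    (ht : 0 ≤ t) (i : E) : IntervalIntegrable (fun s => lam s i) volume 0 t :=
  h.intervalIntegrable ht (continuous_apply i) zero_le_one fun x => by
    rw [one_mul]
    exact abs_apply_le_l1Norm x i

/-- The state `ξ` and the input `u` are dominated, up to the factor `M`, by the level and the inflow
of a scalar balance equation. -/
def IsDominatedByBalance (D : Set (ℝ × ℝ)) (M : ℝ) (u ξ : ℝ → E → ℝ) : Prop :=
  ∃ A v p : ℝ → ℝ, IsScalarBalance D A v p ∧ (∀ t, 0 ≤ t → l1Norm (ξ t) ≤ v t) ∧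
    v 0 ≤ M * l1Norm (ξ 0) ∧ (∀ t, 0 ≤ t → A t ≤ M * l1Norm (u t)) ∧
    ∀ t, 0 ≤ t → IntervalIntegrable (fun s => l1Norm (u s)) volume 0 t

theorem IsPositiveOutflow.exists_iISS_bound_of_isDominated {D : Set (ℝ × ℝ)}
    (hD : IsPositiveOutflow D) {M : ℝ} (hM : 0 < M) :
    ∃ β, IsClassKL β ∧ ∀ u ξ : ℝ → E → ℝ, IsDominatedByBalance D M u ξ → ∀ t, 0 ≤ t →
      l1Norm (ξ t) ≤ β (l1Norm (ξ 0)) t + 2 * M * ∫ s in (0 : ℝ)..t, l1Norm (u s) := by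
  obtain ⟨β, hβ, hβ'⟩ := hD.exists_iISS_bound
  refine ⟨_, hβ.comp_const_mul hM, ?_⟩
  rintro u ξ ⟨A, v, p, h, hξ, hv0, hA, hu⟩ t ht
  have h1 := hβ' A v p h t ht
  have h2 : β (v 0) t ≤ β (M * l1Norm (ξ 0)) t := (hβ.strictMonoOn t ht).monotoneOn
    (hD.level_nonneg _ (h.mem 0 le_rfl)) (mul_nonneg hM.le (l1Norm_nonneg _)) hv0
  have h3 : ∫ s in (0 : ℝ)..t, A s ≤ ∫ s in (0 : ℝ)..t, M * l1Norm (u s) :=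
    intervalIntegral.integral_mono_on ht (h.intervalIntegrable t ht) ((hu t ht).const_mul M)
      fun s hs => hA s hs.1
  rw [intervalIntegral.integral_const_mul] at h3
  linarith [hξ t ht]

theorem IsPositiveOutflow.exists_ISS_bound_of_isDominated {D : Set (ℝ × ℝ)}
    (hD : IsPositiveOutflow D) {μ : ℝ → ℝ} {S : Set ℝ} (hμ : IsClassKInf μ) (hS : ∀ c ∈ S, 0 ≤ c)
    (hgain : ∀ c ∈ S, ∀ q ∈ D, μ c ≤ q.1 → c * (1 + q.1) ≤ q.2 * q.1) {M : ℝ} (hM : 0 < M) :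
    ∃ β, IsClassKL β ∧ ∀ u ξ : ℝ → E → ℝ, IsDominatedByBalance D M u ξ → essSupNorm u < ⊤ →
      M * (essSupNorm u).toReal ∈ S → ∀ t, 0 ≤ t →
      l1Norm (ξ t) ≤ β (l1Norm (ξ 0)) t + μ (M * (essSupNorm u).toReal) := by
  obtain ⟨β, hβ, hβ'⟩ := hD.exists_ISS_bound hμ hS hgain
  refine ⟨_, hβ.comp_const_mul hM, ?_⟩
  rintro u ξ ⟨A, v, p, h, hξ, hv0, hA, hu⟩ hutop huS t ht
  have h1 := hβ' A v p h _ huS (by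
    filter_upwards [ae_l1Norm_le_of_essSupNorm_lt_top hutop, ae_restrict_mem measurableSet_Ici]
      with s hs hs0
    exact (hA s hs0).trans (mul_le_mul_of_nonneg_left hs hM.le)) t ht
  have h2 : β (v 0) t ≤ β (M * l1Norm (ξ 0)) t := (hβ.strictMonoOn t ht).monotoneOn
    (hD.level_nonneg _ (h.mem 0 le_rfl)) (mul_nonneg hM.le (l1Norm_nonneg _)) hv0
  linarith [hξ t ht]

theorem IsPositiveOutflow.isIISS {D : Set (ℝ × ℝ)} (hD : IsPositiveOutflow D) {M : ℝ} (hM : 0 < M)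
    {Traj : (ℝ → E → ℝ) → (ℝ → E → ℝ) → Prop}
    (hTraj : ∀ u ξ, Traj u ξ → IsDominatedByBalance D M u ξ) : IsIISS Traj := by
  obtain ⟨β, hβ, hβ'⟩ := hD.exists_iISS_bound_of_isDominated (E := E) hM
  exact ⟨β, _, _, hβ, isClassKInf_const_mul (mul_pos two_pos hM), isClassKInf_id,
    fun u ξ h => hβ' u ξ (hTraj u ξ h)⟩

theorem IsPositiveOutflow.isStrongIISS {D : Set (ℝ × ℝ)} (hD : IsPositiveOutflow D)
    (h0 : ((0 : ℝ), (0 : ℝ)) ∈ D) {C K : ℝ} (hC : 0 < C) (hCK : ∀ p ∈ D, K ≤ p.1 → C ≤ p.2)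
    {M : ℝ} (hM : 0 < M) {Traj : (ℝ → E → ℝ) → (ℝ → E → ℝ) → Prop}
    (hTraj : ∀ u ξ, Traj u ξ → IsDominatedByBalance D M u ξ) : IsStrongIISS Traj := by
  obtain ⟨β₁, hβ₁, hiISS⟩ := hD.exists_iISS_bound_of_isDominated (E := E) hM
  -- Any inflow bound strictly below `C` would do; `C / 2` for the scalar inflow becomes the
  -- threshold `C / 2 / M` for `‖u‖`.
  obtain ⟨μ, hμ, hgain⟩ := hD.exists_gain h0 (half_pos hC).le (half_lt_self hC) hCK
  obtain ⟨β₂, hβ₂, hISS⟩ := hD.exists_ISS_bound_of_isDominated (E := E) hμ (fun c hc => hc.1)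
    hgain hM
  refine ⟨_, _, _, _, hβ₁.add hβ₂, isClassKInf_const_mul (mul_pos two_pos hM), isClassKInf_id,
    hμ.comp_const_mul hM, fun u ξ h t ht => ?_, C / 2 / M, by positivity,
    fun u ξ h hu t ht => ?_⟩
  · have h1 := hiISS u ξ (hTraj u ξ h) t ht
    have h2 := hβ₂.nonneg (l1Norm_nonneg (ξ 0)) ht
    linarith
  · have hutop : essSupNorm u < ⊤ := hu.trans ENNReal.ofReal_lt_top
    have h1 := hISS u ξ (hTraj u ξ h) hutop ⟨by positivity, by
      rw [mul_comm, ← le_div_iff₀ hM]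
      exact ENNReal.toReal_le_of_le_ofReal (by positivity) hu.le⟩ t ht
    have h2 := hβ₁.nonneg (l1Norm_nonneg (ξ 0)) ht
    linarith

end Domination

/-! ### Flow networks -/

section Network

variable {E : Type*} [Fintype E] [DecidableEq E] {R : Matrix E E ℝ} {f : (E → ℝ) → E → ℝ}

theorem IsRoutingMatrix.isUnit_one_sub_transpose (hR : IsRoutingMatrix R)
    (hconn : OutflowConnected R) : IsUnit (1 - R.transpose) := by
  rw [← Matrix.transpose_one, ← Matrix.transpose_sub, Matrix.isUnit_transpose]
  exact hR.isUnit_one_sub hconn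

theorem inv_one_sub_transpose_apply (R : Matrix E E ℝ) (i j : E) :
    (1 - R.transpose)⁻¹ i j = (1 - R)⁻¹ j i := by
  conv_lhs => rw [← Matrix.transpose_one, ← Matrix.transpose_sub, ← Matrix.transpose_nonsing_inv,
    Matrix.transpose_apply]

/-- The total mass `∑ i, z_i` in the coordinates `z = (I - Rᵀ)⁻¹ x`. -/
def networkLevel (R : Matrix E E ℝ) (x : E → ℝ) : ℝ := ∑ i, (1 - R.transpose)⁻¹.mulVec x i

theorem continuous_networkLevel (R : Matrix E E ℝ) : Continuous (networkLevel R) := by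
  unfold networkLevel Matrix.mulVec dotProduct
  fun_prop

theorem networkLevel_eq_sum (R : Matrix E E ℝ) (x : E → ℝ) :
    networkLevel R x = ∑ j, (∑ i, (1 - R.transpose)⁻¹ i j) * x j := by
  simp only [networkLevel, Matrix.mulVec, dotProduct, Finset.sum_mul]
  exact Finset.sum_comm

theorem networkLevel_mulVec (hR : IsRoutingMatrix R) (hconn : OutflowConnected R) (y : E → ℝ) :
    networkLevel R ((1 - R.transpose).mulVec y) = ∑ i, y i := by
  have hdet := (Matrix.isUnit_iff_isUnit_det _).1 (hR.isUnit_one_sub_transpose hconn)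
  rw [networkLevel, Matrix.mulVec_mulVec, Matrix.nonsing_inv_mul _ hdet, Matrix.one_mulVec]

theorem IsRoutingMatrix.inv_mulVec_nonneg (hR : IsRoutingMatrix R) (hconn : OutflowConnected R)
    {x : E → ℝ} (hx : 0 ≤ x) : 0 ≤ (1 - R.transpose)⁻¹.mulVec x := fun i =>
  Finset.sum_nonneg fun j _ => mul_nonneg
    ((hR.inv_nonneg hconn j i).trans_eq (inv_one_sub_transpose_apply R i j).symm) (hx j)

theorem IsRoutingMatrix.l1Norm_inv_mulVec (hR : IsRoutingMatrix R) (hconn : OutflowConnected R)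
    {x : E → ℝ} (hx : 0 ≤ x) : l1Norm ((1 - R.transpose)⁻¹.mulVec x) = networkLevel R x :=
  l1Norm_of_nonneg (hR.inv_mulVec_nonneg hconn hx)

theorem IsRoutingMatrix.networkLevel_nonneg (hR : IsRoutingMatrix R) (hconn : OutflowConnected R)
    {x : E → ℝ} (hx : 0 ≤ x) : 0 ≤ networkLevel R x :=
  Finset.sum_nonneg fun i _ => hR.inv_mulVec_nonneg hconn hx i

theorem IsRoutingMatrix.l1Norm_le_networkLevel (hR : IsRoutingMatrix R)
    (hconn : OutflowConnected R) {x : E → ℝ} (hx : 0 ≤ x) : l1Norm x ≤ networkLevel R x := by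
  rw [l1Norm_of_nonneg hx, networkLevel_eq_sum]
  refine Finset.sum_le_sum fun j _ => le_mul_of_one_le_left (hx j) ?_
  simp only [inv_one_sub_transpose_apply]
  exact (hR.one_le_inv_diag hconn j).trans
    (Finset.single_le_sum (f := fun i => (1 - R)⁻¹ j i) (fun i _ => hR.inv_nonneg hconn j i)
      (Finset.mem_univ j))

theorem IsRoutingMatrix.exists_networkLevel_le (hR : IsRoutingMatrix R)
    (hconn : OutflowConnected R) :
    ∃ M : ℝ, 0 < M ∧ ∀ x : E → ℝ, 0 ≤ x → networkLevel R x ≤ M * l1Norm x := by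
  have hN : ∀ j, 0 ≤ ∑ i, (1 - R.transpose)⁻¹ i j := fun j => Finset.sum_nonneg fun i _ =>
    inv_one_sub_transpose_apply R i j ▸ hR.inv_nonneg hconn j i
  refine ⟨1 + ∑ j, ∑ i, (1 - R.transpose)⁻¹ i j,
    by have := Finset.sum_nonneg fun j (_ : j ∈ Finset.univ) => hN j; linarith, fun x hx => ?_⟩
  rw [networkLevel_eq_sum, l1Norm_of_nonneg hx, Finset.mul_sum]
  refine Finset.sum_le_sum fun j _ => mul_le_mul_of_nonneg_right ?_ (hx j)
  have := Finset.single_le_sum (fun j _ => hN j) (Finset.mem_univ j)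
  linarith

/-- The pairs of total mass and total outflow that occur in the network. -/
def networkRelation (R : Matrix E E ℝ) (f : (E → ℝ) → E → ℝ) : Set (ℝ × ℝ) :=
  (fun x => (networkLevel R x, ∑ i, f x i)) '' {x | 0 ≤ x}

theorem zero_mem_networkRelation (hf : IsFlowFunction f) :
    ((0 : ℝ), (0 : ℝ)) ∈ networkRelation R f :=
  ⟨0, le_refl (0 : E → ℝ), by simp [networkLevel, (hf.eq_zero_iff 0 le_rfl _).2]⟩

theorem IsFlowFunction.continuousOn_sum {E : Type*} [Fintype E] {f : (E → ℝ) → E → ℝ} (hf : IsFlowFunction f) :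
    ContinuousOn (fun x => ∑ i, f x i) {x : E → ℝ | 0 ≤ x} :=
  continuousOn_finsetSum _ fun i _ =>
    (continuous_apply i).comp_continuousOn hf.locallyLipschitzOn.continuousOn

/-- States with level in `[a, b]` form a compact set because the level dominates the norm. The
continuous outflow attains its minimum there, and it vanishes only at `x = 0`, whose level is `0 <
a`. -/
theorem isPositiveOutflow_networkRelation (hR : IsRoutingMatrix R) (hconn : OutflowConnected R)
    (hf : IsFlowFunction f) : IsPositiveOutflow (networkRelation R f) where
  level_nonneg := by
    rintro _ ⟨x, hx, rfl⟩
    exact hR.networkLevel_nonneg hconn hx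
  outflow_nonneg := by
    rintro _ ⟨x, hx, rfl⟩
    exact Finset.sum_nonneg fun i _ => hf.nonneg x hx i
  exists_lower_bound := by
    intro a b ha
    set s : Set (E → ℝ) := {x | 0 ≤ x ∧ a ≤ networkLevel R x ∧ networkLevel R x ≤ b} with hs
    have hclosed : IsClosed s :=
      (isClosed_le continuous_const continuous_id).inter
        ((isClosed_le continuous_const (continuous_networkLevel R)).inter
          (isClosed_le (continuous_networkLevel R) continuous_const))
    have hcomp : IsCompact s := by
      refine (isCompact_Icc (a := (0 : E → ℝ)) (b := fun _ => b)).of_isClosed_subset hclosed ?_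
      rintro x ⟨hx, -, hxb⟩
      exact ⟨hx, fun i => (le_abs_self _).trans ((abs_apply_le_l1Norm x i).trans
        ((hR.l1Norm_le_networkLevel hconn hx).trans hxb))⟩
    rcases s.eq_empty_or_nonempty with hempty | hne
    · refine ⟨1, one_pos, ?_⟩
      rintro _ ⟨x, hx, rfl⟩ h1 h2
      have : x ∈ s := ⟨hx, h1, h2⟩
      simp [hempty] at this
    · obtain ⟨x₀, hx₀, hmin⟩ := hcomp.exists_isMinOn hne
        (hf.continuousOn_sum.mono fun x hx => hx.1)
      refine ⟨∑ i, f x₀ i, ?_, ?_⟩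
      · refine (Finset.sum_nonneg fun i _ => hf.nonneg x₀ hx₀.1 i).lt_of_ne fun h => ?_
        have h1 := (Finset.sum_eq_zero_iff_of_nonneg
          fun i _ => hf.nonneg x₀ hx₀.1 i).1 h.symm
        have h2 : x₀ = 0 := funext fun i =>
          (hf.eq_zero_iff x₀ hx₀.1 i).1 (h1 i (Finset.mem_univ i))
        have h3 := hx₀.2.1
        simp only [h2, networkLevel, Matrix.mulVec_zero, Pi.zero_apply,
          Finset.sum_const_zero] at h3
        linarith
      · rintro _ ⟨x, hx, rfl⟩ h1 h2
        exact hmin (show x ∈ s from ⟨hx, h1, h2⟩)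

/-- Below the lower limit of the total outflow, the total outflow is bounded below at high levels. -/
theorem exists_le_of_lt_liminfOutflow (hR : IsRoutingMatrix R) (hconn : OutflowConnected R)
    {C : ℝ} (hC : ENNReal.ofReal C < liminfOutflow f) :
    ∃ K, ∀ p ∈ networkRelation R f, K ≤ p.1 → C ≤ p.2 := by
  obtain ⟨M, hM, hMx⟩ := hR.exists_networkLevel_le hconn
  have h1 := Filter.eventually_lt_of_lt_liminf hC
  rw [Filter.eventually_inf_principal, Filter.eventually_comap] at h1
  obtain ⟨K, hK⟩ := Filter.eventually_atTop.1 h1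
  refine ⟨M * K, ?_⟩
  rintro _ ⟨x, hx, rfl⟩ h
  have h2 : K ≤ l1Norm x := le_of_mul_le_mul_left (h.trans (hMx x hx)) hM
  have h3 := hK _ h2 x rfl hx
  by_contra hlt
  exact h3.not_ge (ENNReal.ofReal_le_ofReal (not_le.1 hlt).le)

/-- Weighting the coordinate equations by the column sums of `(I - Rᵀ)⁻¹` turns `(I - Rᵀ) f(x)` into
`∑ f_i(x)`. -/
theorem IsSolution.isScalarBalance (hR : IsRoutingMatrix R) (hconn : OutflowConnected R)
    (hf : IsFlowFunction f) {lam x : ℝ → E → ℝ} (h : IsSolution R f lam x) :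
    IsScalarBalance (networkRelation R f) (fun t => networkLevel R (lam t))
      (fun t => networkLevel R (x t)) (fun t => ∑ i, f (x t) i) where
  mem := fun t ht => ⟨x t, h.nonneg t ht, rfl⟩
  continuousOn_level := (continuous_networkLevel R).comp_continuousOn h.continuousOn
  continuousOn_outflow := hf.continuousOn_sum.comp h.continuousOn h.nonneg
  inflow_nonneg := fun t ht => hR.networkLevel_nonneg hconn (h.inflow.nonneg t ht)
  intervalIntegrable := fun t ht => by
    simp only [networkLevel_eq_sum]
    rw [← Finset.sum_fn]
    exact IntervalIntegrable.sum _ fun j _ => (h.inflow.intervalIntegrable_apply ht j).const_mul _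
  eq_integral := by
    intro t ht
    have hfx : ContinuousOn (fun s => f (x s)) (Set.Ici 0) :=
      hf.locallyLipschitzOn.continuousOn.comp h.continuousOn h.nonneg
    have hint : ∀ i, IntervalIntegrable
        (fun s => lam s i - (1 - R.transpose).mulVec (f (x s)) i) volume 0 t := by
      intro i
      refine (h.inflow.intervalIntegrable_apply ht i).sub (ContinuousOn.intervalIntegrable ?_)
      rw [Set.uIcc_of_le ht]
      have hc : Continuous fun y : E → ℝ => (1 - R.transpose).mulVec y i := by
        unfold Matrix.mulVec dotProduct
        fun_prop
      exact hc.comp_continuousOn (hfx.mono fun s hs => hs.1)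
    have hpt : ∀ s, networkLevel R (lam s) - ∑ i, f (x s) i = ∑ j,
        (∑ i, (1 - R.transpose)⁻¹ i j) * (lam s j - (1 - R.transpose).mulVec (f (x s)) j) := by
      intro s
      rw [← networkLevel_mulVec hR hconn (f (x s))]
      simp only [networkLevel_eq_sum, mul_sub, Finset.sum_sub_distrib]
    simp only [hpt]
    rw [intervalIntegral.integral_finsetSum fun j _ => (hint j).const_mul _]
    simp only [intervalIntegral.integral_const_mul, networkLevel_eq_sum]
    rw [← Finset.sum_add_distrib]
    refine Finset.sum_congr rfl fun j _ => ?_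
    rw [h.integral_eq t ht j]
    ring

theorem IsSolution.exists_isDominatedByBalance (hR : IsRoutingMatrix R)
    (hconn : OutflowConnected R) (hf : IsFlowFunction f) :
    ∃ M, 0 < M ∧ ∀ lam x, IsSolution R f lam x →
      IsDominatedByBalance (networkRelation R f) M lam x := by
  obtain ⟨M, hM, hMx⟩ := hR.exists_networkLevel_le hconn
  exact ⟨M, hM, fun lam x h => ⟨_, _, _, h.isScalarBalance hR hconn hf,
    fun t ht => hR.l1Norm_le_networkLevel hconn (h.nonneg t ht), hMx _ (h.nonneg 0 le_rfl),
    fun t ht => hMx _ (h.inflow.nonneg t ht),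
    fun t ht => h.inflow.intervalIntegrable_l1Norm ht⟩⟩

/-- Here level and scalar inflow are exactly `‖z‖` and `‖a‖`, so the factor is `1`; this is what
makes the ISS threshold sharp. -/
theorem IsTransformedSolution.isDominatedByBalance (hR : IsRoutingMatrix R)
    (hconn : OutflowConnected R) (hf : IsFlowFunction f) {a z : ℝ → E → ℝ}
    (h : IsTransformedSolution R f a z) : IsDominatedByBalance (networkRelation R f) 1 a z := by
  obtain ⟨lam, x, h, rfl, rfl⟩ := h
  have hb := h.isScalarBalance hR hconn hf
  have hlam : ∀ t, 0 ≤ t → l1Norm ((1 - R.transpose)⁻¹.mulVec (lam t)) = networkLevel R (lam t) :=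
    fun t ht => hR.l1Norm_inv_mulVec hconn (h.inflow.nonneg t ht)
  refine ⟨_, _, _, hb, fun t ht => (hR.l1Norm_inv_mulVec hconn (h.nonneg t ht)).le, ?_,
    fun t ht => ?_, fun t ht => ?_⟩
  · rw [one_mul, hR.l1Norm_inv_mulVec hconn (h.nonneg 0 le_rfl)]
  · rw [one_mul, hlam t ht]
  · refine (hb.intervalIntegrable t ht).congr fun s hs => ?_
    rw [Set.uIoc_of_le ht] at hs
    exact (hlam s hs.1.le).symm

theorem IsTransformedSolution.essSupNorm_eq (hR : IsRoutingMatrix R)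
    (hconn : OutflowConnected R) {a z : ℝ → E → ℝ} (h : IsTransformedSolution R f a z) :
    essSupNorm a =
      essSup (fun t => ENNReal.ofReal (∑ i, a t i)) (volume.restrict (Set.Ici 0)) := by
  obtain ⟨lam, x, h, rfl, rfl⟩ := h
  refine essSup_congr_ae ?_
  filter_upwards [ae_restrict_mem measurableSet_Ici] with t ht
  rw [hR.l1Norm_inv_mulVec hconn (h.inflow.nonneg t ht), networkLevel]

end Network

end

/-! ### The main theorem -/

theorem theorem1 {E : Type*} [Fintype E] [DecidableEq E]
    (R : Matrix E E ℝ) (hR : IsRoutingMatrix R) (hconn : OutflowConnected R)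
    (f : (E → ℝ) → E → ℝ) (hf : IsFlowFunction f) :
    IsUnit (1 - R.transpose) ∧
    -- integral ISS in the transformed coordinates
    IsIISS (IsTransformedSolution R f) ∧
    -- ISS for the inflows with `ess sup ∑ i, a i < liminf ∑ i, f i`, uniformly below each level `U`
    (∀ U : ℝ≥0∞, U < liminfOutflow f →
      IsISS (fun a z => IsTransformedSolution R f a z ∧
        essSup (fun t => ENNReal.ofReal (∑ i, a t i)) (volume.restrict (Set.Ici 0)) ≤ U)) ∧
    -- if the bound is infinite, ISS uniformly for all essentially bounded inflows
    (liminfOutflow f = ⊤ → IsISS (IsTransformedSolution R f)) ∧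
    -- Strong iISS, in the transformed and in the original coordinates
    (0 < liminfOutflow f →
      IsStrongIISS (IsTransformedSolution R f) ∧ IsStrongIISS (IsSolution R f)) := by
  have hD := isPositiveOutflow_networkRelation hR hconn hf
  have h0 := zero_mem_networkRelation (R := R) hf
  have hdom := fun a z (h : IsTransformedSolution R f a z) => h.isDominatedByBalance hR hconn hf
  refine ⟨hR.isUnit_one_sub_transpose hconn, hD.isIISS one_pos hdom, fun U hU => ?_, fun hL => ?_,
    fun hL => ?_⟩
  -- A level `C` strictly between `U` and the lower limit leaves the margin needed to build a gain.
  · obtain ⟨C, hUC, hC⟩ := ENNReal.lt_iff_exists_nnreal_btwn.1 hU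
    obtain ⟨K, hK⟩ := exists_le_of_lt_liminfOutflow hR hconn (C := C) (by simpa using hC)
    obtain ⟨μ, hμ, hgain⟩ := hD.exists_gain h0 ENNReal.toReal_nonneg
      (ENNReal.toReal_lt_of_lt_ofReal (by simpa using hUC)) hK
    obtain ⟨β, hβ, hβ'⟩ := hD.exists_ISS_bound_of_isDominated (E := E) hμ (fun c hc => hc.1) hgain
      one_pos
    refine ⟨β, μ, hβ, hμ, fun a z h ha t ht => ?_⟩
    have h1 := hβ' a z (hdom a z h.1) ha ⟨by positivity, by
      rw [one_mul, h.1.essSupNorm_eq hR hconn]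
      exact ENNReal.toReal_mono hU.ne_top h.2⟩ t ht
    rwa [one_mul] at h1
  · obtain ⟨μ, hμ, hgain⟩ := hD.exists_gain_of_unbounded h0 fun C =>
      exists_le_of_lt_liminfOutflow hR hconn (hL ▸ ENNReal.ofReal_lt_top)
    obtain ⟨β, hβ, hβ'⟩ := hD.exists_ISS_bound_of_isDominated (E := E) hμ
      (fun c hc => Set.mem_Ici.1 hc) hgain one_pos
    refine ⟨β, μ, hβ, hμ, fun a z h ha t ht => ?_⟩
    have h1 := hβ' a z (hdom a z h) ha (by rw [Set.mem_Ici]; positivity) t ht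
    rwa [one_mul] at h1
  · obtain ⟨C, hC0, hC⟩ := ENNReal.lt_iff_exists_nnreal_btwn.1 hL
    obtain ⟨K, hK⟩ := exists_le_of_lt_liminfOutflow hR hconn (C := C) (by simpa using hC)
    have hC0' : (0 : ℝ) < C := by exact_mod_cast hC0
    obtain ⟨M, hM, hMdom⟩ := IsSolution.exists_isDominatedByBalance hR hconn hf
    exact ⟨hD.isStrongIISS h0 hC0' hK one_pos hdom, hD.isStrongIISS h0 hC0' hK hM hMdom⟩
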